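/- A lattice polygon is a two-dimensional convex polygon $\Delta\subset\mathbb{R}^2$ all of whose vertices lie in $\mathbb{Z}^2$. Its genus is the number of points of $\mathbb{Z}^2$ in its interior, and its interior polygon $\Delta^{(1)}$ is the convex hull of these points. $\Delta$ is nonhyperelliptic if $\Delta^{(1)}$ is two-dimensional, and maximal if no lattice polygon $\Delta'$ properly containing $\Delta$ satisfies $(\Delta')^{(1)}=\Delta^{(1)}$. Two lattice polygons are equivalent if one is the image of the other under a map $v\mapsto Av+t$ with $A\in\mathrm{GL}_2(\mathbb{Z})$ and $t\in\mathbb{Z}^2$. **Proposition.** (a) A subset of $\mathbb{R}^2$ is a maximal nonhyperelliptic lattice polygon of genus $6$ if and only if it is equivalent to one of the following five polygons, which are pairwise inequivalent (each given by its vertices): 1. $(0,0),(5,0),(0,5)$; 2. $(0,0),(4,0),(4,3),(0,3)$; 3. $(0,0),(7,0),(1,3),(0,3)$; 4. $(0,0),(2,0),(4,2),(0,4)$; 5. $(0,0),(2,0),(4,2),(2,4),(0,2)$. (b) A subset of $\mathbb{R}^2$ is a maximal nonhyperelliptic lattice polygon of genus $7$ if and only if it is equivalent to one of the following seven polygons,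 which are pairwise inequivalent: 1. $(0,0),(6,0),(3,3),(0,3)$; 2. $(0,0),(9,0),(0,3)$; 3. $(0,0),(1,0),(5,2),(3,4),(2,4)$; 4. $(0,0),(4,0),(0,6)$; 5. $(0,0),(2,0),(4,4),(0,4)$; 6. $(0,0),(2,0),(4,2),(2,4),(0,4)$; 7. $(0,0),(2,0),(4,2),(4,4),(2,4),(0,2)$. -/

import Mathlib

/-- The lattice point of the plane with the given integer coordinates. -/
def latticePt (p : ℤ × ℤ) : ℝ × ℝ := ((p.1 : ℝ), (p.2 : ℝ))

/-- The convex hull in the plane of a set of lattice points. -/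
def latticeHull (S : Set (ℤ × ℤ)) : Set (ℝ × ℝ) := convexHull ℝ (latticePt '' S)

/-- A (convex) lattice polygon: the convex hull of finitely many lattice points that is
two-dimensional, i.e. has nonempty interior in the plane. -/
def IsLatticePolygon (P : Set (ℝ × ℝ)) : Prop :=
  (∃ S : Finset (ℤ × ℤ), P = latticeHull (S : Set (ℤ × ℤ))) ∧ (interior P).Nonempty

/-- The integer points in the topological interior of `P`. -/
def interiorLatticePoints (P : Set (ℝ × ℝ)) : Set (ℤ × ℤ) :=
  {p | latticePt p ∈ interior P}

/-- The genus: the number of interior lattice points. -/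
noncomputable def latticeGenus (P : Set (ℝ × ℝ)) : ℕ := (interiorLatticePoints P).ncard

/-- The interior polygon: the convex hull of the interior lattice points. -/
def interiorPolygon (P : Set (ℝ × ℝ)) : Set (ℝ × ℝ) := latticeHull (interiorLatticePoints P)

/-- `P` is nonhyperelliptic when its interior polygon is two-dimensional. -/
def IsNonhyperelliptic (P : Set (ℝ × ℝ)) : Prop := (interior (interiorPolygon P)).Nonempty

/-- `P` is maximal when no lattice polygon with the same interior polygon properly contains it. -/
def IsMaximalPolygon (P : Set (ℝ × ℝ)) : Prop :=
  ¬ ∃ Q : Set (ℝ × ℝ), IsLatticePolygon Q ∧ P ⊂ Q ∧ interiorPolygon Q = interiorPolygon P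

/-- `P` is a maximal nonhyperelliptic lattice polygon of genus `g`. -/
def IsMaximalNonhyperelliptic (g : ℕ) (P : Set (ℝ × ℝ)) : Prop :=
  IsLatticePolygon P ∧ latticeGenus P = g ∧ IsNonhyperelliptic P ∧ IsMaximalPolygon P

/-- The affine map `v ↦ A v + t` of the plane given by an integer matrix and an integer vector. -/
def integralAffineMap (A : Matrix (Fin 2) (Fin 2) ℤ) (t : ℤ × ℤ) (v : ℝ × ℝ) : ℝ × ℝ :=
  ((A 0 0 : ℝ) * v.1 + (A 0 1 : ℝ) * v.2 + (t.1 : ℝ),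
    (A 1 0 : ℝ) * v.1 + (A 1 1 : ℝ) * v.2 + (t.2 : ℝ))

/-- Equivalence of lattice polygons: an affine map `v ↦ A v + t` with `A` an integer matrix of
determinant `1` or `-1` and `t` an integer vector carries `P` onto `Q`. -/
def LatticeEquivalent (P Q : Set (ℝ × ℝ)) : Prop :=
  ∃ (A : Matrix (Fin 2) (Fin 2) ℤ) (t : ℤ × ℤ),
    (A.det = 1 ∨ A.det = -1) ∧ integralAffineMap A t '' P = Q

/-- The five polygons of genus 6, each given by its vertices. -/
def genusSixPolygons : List (Set (ℝ × ℝ)) :=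
  [latticeHull {(0, 0), (5, 0), (0, 5)},
   latticeHull {(0, 0), (4, 0), (4, 3), (0, 3)},
   latticeHull {(0, 0), (7, 0), (1, 3), (0, 3)},
   latticeHull {(0, 0), (2, 0), (4, 2), (0, 4)},
   latticeHull {(0, 0), (2, 0), (4, 2), (2, 4), (0, 2)}]

/-- The seven polygons of genus 7, each given by its vertices. -/
def genusSevenPolygons : List (Set (ℝ × ℝ)) :=
  [latticeHull {(0, 0), (6, 0), (3, 3), (0, 3)},
   latticeHull {(0, 0), (9, 0), (0, 3)},
   latticeHull {(0, 0), (1, 0), (5, 2), (3, 4), (2, 4)},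
   latticeHull {(0, 0), (4, 0), (0, 6)},
   latticeHull {(0, 0), (2, 0), (4, 4), (0, 4)},
   latticeHull {(0, 0), (2, 0), (4, 2), (2, 4), (0, 4)},
   latticeHull {(0, 0), (2, 0), (4, 2), (4, 4), (2, 4), (0, 2)}]

/-! The interior lattice points of a lattice polygon P form a set R containing every lattice point
of its own convex hull, and P is nonhyperelliptic exactly when R is not collinear. Everything rests
on one fact (`exists_height_one`): over a primitive lattice segment, a triangle of height at least
two contains a lattice point at height one. So if a primitive segment with ends in R has R on its
left, then every lattice point of P has height at least -1 over it (`neg_one_le_orient_of_mem`), and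
so does every point that can be added to R without losing lattice convexity
(`neg_one_le_orient_of_isLatticeConvex`).

The second bound makes the sets R enumerable. Up to equivalence R contains the standard triangle,
and while R is larger, an extreme point outside that triangle can be removed. Sets of n + 1 points
thus arise from sets of n points by adding one of finitely many candidates (`Classifies.extend`).
The tables end with 13 sets of 6 points and 21 sets of 7 points.

The first bound confines P to the hull of the relaxation of R. Either some point of R is on the
boundary of this hull, and R does not occur (`IsObstructed`), or the hull has interior lattice
points R and is the only maximal polygon belonging to R (`IsRelaxedHull`). Inequivalence follows
from an invariant of R, `quarticInvariant`. -/

/-! ### Unimodular maps and the invariance of all notions under them. -/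

/-- An integral affine map `(x, y) ↦ (a x + b y + e, c x + d y + f)`. -/
structure IntAffine where
  (a b c d e f : ℤ)

namespace IntAffine

/-- The action on lattice points. -/
def apply (m : IntAffine) (p : ℤ × ℤ) : ℤ × ℤ :=
  (m.a * p.1 + m.b * p.2 + m.e, m.c * p.1 + m.d * p.2 + m.f)

/-- The action on the real plane. -/
def toReal (m : IntAffine) (v : ℝ × ℝ) : ℝ × ℝ :=
  (m.a * v.1 + m.b * v.2 + m.e, m.c * v.1 + m.d * v.2 + m.f)

/-- The determinant of the linear part. -/
def det (m : IntAffine) : ℤ := m.a * m.d - m.b * m.c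

/-- The linear part is invertible over the integers. -/
def IsUnimodular (m : IntAffine) : Prop := m.det = 1 ∨ m.det = -1

/-- The inverse of a unimodular map. -/
def inv (m : IntAffine) : IntAffine where
  a := m.det * m.d
  b := -(m.det * m.b)
  c := -(m.det * m.c)
  d := m.det * m.a
  e := m.det * (m.b * m.f - m.d * m.e)
  f := m.det * (m.c * m.e - m.a * m.f)

/-- The composition `m ∘ n`. -/
def comp (m n : IntAffine) : IntAffine where
  a := m.a * n.a + m.b * n.c
  b := m.a * n.b + m.b * n.d
  c := m.c * n.a + m.d * n.c
  d := m.c * n.b + m.d * n.d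
  e := m.a * n.e + m.b * n.f + m.e
  f := m.c * n.e + m.d * n.f + m.f

theorem comp_apply (m n : IntAffine) (p : ℤ × ℤ) :
    (m.comp n).apply p = m.apply (n.apply p) := by
  ext <;> simp only [comp, apply] <;> ring

theorem det_comp (m n : IntAffine) : (m.comp n).det = m.det * n.det := by
  simp only [comp, det]; ring

theorem IsUnimodular.comp {m n : IntAffine} (hm : m.IsUnimodular) (hn : n.IsUnimodular) :
    (m.comp n).IsUnimodular := by
  unfold IsUnimodular at *
  rw [det_comp]
  rcases hm with h | h <;> rcases hn with h' | h' <;> simp [h, h']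

theorem IsUnimodular.sq {m : IntAffine} (h : m.IsUnimodular) : m.det * m.det = 1 := by
  rcases h with h | h <;> simp [h]

theorem det_inv {m : IntAffine} (h : m.IsUnimodular) : m.inv.det = m.det := by
  have h1 : m.inv.det = m.det * m.det * (m.a * m.d - m.b * m.c) := by
    simp only [inv, det]; ring
  rw [h1, h.sq, one_mul, det]

theorem IsUnimodular.inv {m : IntAffine} (h : m.IsUnimodular) : m.inv.IsUnimodular := by
  unfold IsUnimodular
  rw [det_inv h]
  exact h

theorem toReal_latticePt (m : IntAffine) (p : ℤ × ℤ) :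
    m.toReal (latticePt p) = latticePt (m.apply p) := by
  simp [toReal, apply, latticePt]

theorem inv_toReal_toReal {m : IntAffine} (h : m.IsUnimodular) (v : ℝ × ℝ) :
    m.inv.toReal (m.toReal v) = v := by
  -- The inverse is the adjugate multiplied, not divided, by the determinant; this is correct
  -- because the determinant squares to one.
  have h1 : (m.det : ℝ) * (m.a * m.d - m.b * m.c) = 1 := by exact_mod_cast h.sq
  ext
  · simp only [toReal, inv]; push_cast; linear_combination v.1 * h1
  · simp only [toReal, inv]; push_cast; linear_combination v.2 * h1

theorem toReal_inv_toReal {m : IntAffine} (h : m.IsUnimodular) (v : ℝ × ℝ) :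
    m.toReal (m.inv.toReal v) = v := by
  have h1 : (m.det : ℝ) * (m.a * m.d - m.b * m.c) = 1 := by exact_mod_cast h.sq
  ext
  · simp only [toReal, inv]; push_cast; linear_combination (v.1 - m.e) * h1
  · simp only [toReal, inv]; push_cast; linear_combination (v.2 - m.f) * h1

theorem continuous_toReal (m : IntAffine) : Continuous m.toReal := by
  unfold toReal; fun_prop

/-- A unimodular map as a homeomorphism of the plane. -/
def homeomorph (m : IntAffine) (h : m.IsUnimodular) : (ℝ × ℝ) ≃ₜ (ℝ × ℝ) where
  toFun := m.toReal
  invFun := m.inv.toReal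
  left_inv := inv_toReal_toReal h
  right_inv := toReal_inv_toReal h
  continuous_toFun := m.continuous_toReal
  continuous_invFun := m.inv.continuous_toReal

theorem toReal_injective {m : IntAffine} (h : m.IsUnimodular) : Function.Injective m.toReal :=
  (m.homeomorph h).injective

theorem latticePt_injective : Function.Injective latticePt := by
  intro p q h
  simpa [latticePt, Prod.ext_iff] using h

theorem inv_apply_apply {m : IntAffine} (h : m.IsUnimodular) (p : ℤ × ℤ) :
    m.inv.apply (m.apply p) = p :=
  latticePt_injective <| by
    rw [← toReal_latticePt, ← toReal_latticePt, inv_toReal_toReal h]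

theorem apply_inv_apply {m : IntAffine} (h : m.IsUnimodular) (p : ℤ × ℤ) :
    m.apply (m.inv.apply p) = p :=
  latticePt_injective <| by
    rw [← toReal_latticePt, ← toReal_latticePt, toReal_inv_toReal h]

theorem apply_injective {m : IntAffine} (h : m.IsUnimodular) : Function.Injective m.apply :=
  Function.LeftInverse.injective (inv_apply_apply h)

theorem image_interior {m : IntAffine} (h : m.IsUnimodular) (P : Set (ℝ × ℝ)) :
    m.toReal '' interior P = interior (m.toReal '' P) :=
  (m.homeomorph h).image_interior P

/-- The affine map underlying `toReal`. -/
noncomputable def toAffineMap (m : IntAffine) : (ℝ × ℝ) →ᵃ[ℝ] (ℝ × ℝ) where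
  toFun := m.toReal
  linear :=
    { toFun := fun v => (m.a * v.1 + m.b * v.2, m.c * v.1 + m.d * v.2)
      map_add' := fun v w => by ext <;> simp <;> ring
      map_smul' := fun r v => by ext <;> simp <;> ring }
  map_vadd' := fun v w => by ext <;> simp [toReal] <;> ring

theorem image_latticeHull (m : IntAffine) (S : Set (ℤ × ℤ)) :
    m.toReal '' latticeHull S = latticeHull (m.apply '' S) := by
  have h := m.toAffineMap.image_convexHull (latticePt '' S)
  have h2 : (m.toAffineMap : ℝ × ℝ → ℝ × ℝ) = m.toReal := rfl
  rw [h2] at h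
  rw [latticeHull, h, latticeHull, Set.image_image, Set.image_image]
  simp only [toReal_latticePt]

theorem interiorLatticePoints_image {m : IntAffine} (h : m.IsUnimodular) (P : Set (ℝ × ℝ)) :
    interiorLatticePoints (m.toReal '' P) = m.apply '' interiorLatticePoints P := by
  ext p
  simp only [interiorLatticePoints, Set.mem_ofPred_eq, ← image_interior h, Set.mem_image]
  constructor
  · rintro ⟨v, hv, hvp⟩
    refine ⟨m.inv.apply p, ?_, apply_inv_apply h p⟩
    rwa [← toReal_latticePt, ← hvp, inv_toReal_toReal h]
  · rintro ⟨q, hq, rfl⟩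
    exact ⟨_, hq, toReal_latticePt m q⟩

theorem interiorPolygon_image {m : IntAffine} (h : m.IsUnimodular) (P : Set (ℝ × ℝ)) :
    interiorPolygon (m.toReal '' P) = m.toReal '' interiorPolygon P := by
  rw [interiorPolygon, interiorLatticePoints_image h, ← image_latticeHull, interiorPolygon]

theorem inv_image_image {m : IntAffine} (h : m.IsUnimodular) (P : Set (ℝ × ℝ)) :
    m.inv.toReal '' (m.toReal '' P) = P := by
  rw [Set.image_image]; simp [inv_toReal_toReal h]

end IntAffine

open IntAffine

theorem latticeEquivalent_iff {P Q : Set (ℝ × ℝ)} :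
    LatticeEquivalent P Q ↔ ∃ m : IntAffine, m.IsUnimodular ∧ m.toReal '' P = Q := by
  constructor
  · rintro ⟨A, t, hA, rfl⟩
    refine ⟨⟨A 0 0, A 0 1, A 1 0, A 1 1, t.1, t.2⟩, ?_, rfl⟩
    rwa [Matrix.det_fin_two] at hA
  · rintro ⟨m, hm, rfl⟩
    refine ⟨!![m.a, m.b; m.c, m.d], (m.e, m.f), ?_, ?_⟩
    · rw [Matrix.det_fin_two]; simpa [IsUnimodular, IntAffine.det] using hm
    · congr 1

theorem LatticeEquivalent.symm {P Q : Set (ℝ × ℝ)} (h : LatticeEquivalent P Q) :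
    LatticeEquivalent Q P := by
  obtain ⟨m, hm, rfl⟩ := latticeEquivalent_iff.1 h
  exact latticeEquivalent_iff.2 ⟨m.inv, hm.inv, inv_image_image hm P⟩

theorem IsLatticePolygon.image {P : Set (ℝ × ℝ)} (hP : IsLatticePolygon P) {m : IntAffine}
    (hm : m.IsUnimodular) : IsLatticePolygon (m.toReal '' P) := by
  obtain ⟨⟨S, rfl⟩, hi⟩ := hP
  refine ⟨⟨S.image m.apply, ?_⟩, ?_⟩
  · rw [image_latticeHull, Finset.coe_image]
  · rw [← image_interior hm]
    exact hi.image _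

theorem IsMaximalPolygon.image {P : Set (ℝ × ℝ)} (hP : IsMaximalPolygon P) {m : IntAffine}
    (hm : m.IsUnimodular) : IsMaximalPolygon (m.toReal '' P) := by
  rintro ⟨Q, hQ, hPQ, hi⟩
  refine hP ⟨m.inv.toReal '' Q, hQ.image hm.inv, ?_, ?_⟩
  · rw [← inv_image_image hm P]
    exact (toReal_injective hm.inv).image_strictMono hPQ
  · rw [interiorPolygon_image hm.inv, hi, interiorPolygon_image hm, inv_image_image hm]

theorem IsMaximalNonhyperelliptic.image {g : ℕ} {P : Set (ℝ × ℝ)}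
    (hP : IsMaximalNonhyperelliptic g P) {m : IntAffine} (hm : m.IsUnimodular) :
    IsMaximalNonhyperelliptic g (m.toReal '' P) := by
  obtain ⟨h1, h2, h3, h4⟩ := hP
  refine ⟨h1.image hm, ?_, ?_, h4.image hm⟩
  · rw [← h2, latticeGenus, interiorLatticePoints_image hm,
      Set.ncard_image_of_injective _ (apply_injective hm), latticeGenus]
  · rw [IsNonhyperelliptic, interiorPolygon_image hm, ← image_interior hm]
    exact Set.Nonempty.image _ h3

/-! ### Signed areas, half-planes and triangles. -/

/-- Twice the signed area of the triangle with vertices `a`, `b`, `c`. -/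
def orient (a b c : ℤ × ℤ) : ℤ := (b.1 - a.1) * (c.2 - a.2) - (b.2 - a.2) * (c.1 - a.1)

/-- Twice the signed area of the triangle with vertices `a`, `b` and a real point `v`. -/
def orientReal (a b : ℤ × ℤ) (v : ℝ × ℝ) : ℝ :=
  (b.1 - a.1) * (v.2 - a.2) - (b.2 - a.2) * (v.1 - a.1)

theorem orientReal_latticePt (a b p : ℤ × ℤ) : orientReal a b (latticePt p) = orient a b p := by
  simp [orientReal, orient, latticePt]

theorem continuous_orientReal (a b : ℤ × ℤ) : Continuous (orientReal a b) := by
  unfold orientReal; fun_prop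

theorem IntAffine.orient_apply (m : IntAffine) (a b c : ℤ × ℤ) :
    orient (m.apply a) (m.apply b) (m.apply c) = m.det * orient a b c := by
  simp only [orient, apply, IntAffine.det]; ring

theorem latticeHull_mono {S T : Set (ℤ × ℤ)} (h : S ⊆ T) : latticeHull S ⊆ latticeHull T :=
  convexHull_mono (Set.image_mono h)

theorem convex_latticeHull (S : Set (ℤ × ℤ)) : Convex ℝ (latticeHull S) := convex_convexHull ..

theorem latticePt_mem_latticeHull {S : Set (ℤ × ℤ)} {p : ℤ × ℤ} (h : p ∈ S) :
    latticePt p ∈ latticeHull S :=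
  subset_convexHull _ _ (Set.mem_image_of_mem _ h)

theorem latticeHull_subset {S : Set (ℤ × ℤ)} {K : Set (ℝ × ℝ)} (hK : Convex ℝ K)
    (h : ∀ p ∈ S, latticePt p ∈ K) : latticeHull S ⊆ K :=
  convexHull_min (Set.image_subset_iff.2 h) hK

theorem convex_orientReal_ge (a b : ℤ × ℤ) (k : ℝ) : Convex ℝ {v | k ≤ orientReal a b v} := by
  intro v hv w hw s t hs ht hst
  simp only [Set.mem_ofPred_eq] at *
  have : orientReal a b (s • v + t • w) = s * orientReal a b v + t * orientReal a b w := by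
    have h1 : t = 1 - s := by linarith
    subst h1
    simp [orientReal]; ring
  rw [this]
  calc k = s * k + t * k := by rw [← add_mul, hst, one_mul]
    _ ≤ _ := by gcongr

theorem le_orientReal_of_mem_latticeHull {S : Set (ℤ × ℤ)} {a b : ℤ × ℤ} {k : ℤ}
    (h : ∀ x ∈ S, k ≤ orient a b x) {v : ℝ × ℝ} (hv : v ∈ latticeHull S) :
    (k : ℝ) ≤ orientReal a b v := by
  refine latticeHull_subset (convex_orientReal_ge a b k) (fun p hp => ?_) hv
  rw [Set.mem_ofPred_eq, orientReal_latticePt]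
  exact_mod_cast h p hp

/-- A nonconstant affine function has no minimum at an interior point. -/
theorem lt_orientReal_of_mem_interior {P : Set (ℝ × ℝ)} {a b : ℤ × ℤ} (hab : a ≠ b) {k : ℝ}
    (h : ∀ v ∈ P, k ≤ orientReal a b v) {v : ℝ × ℝ} (hv : v ∈ interior P) :
    k < orientReal a b v := by
  set x : ℝ := (b.1 : ℝ) - a.1
  set y : ℝ := (b.2 : ℝ) - a.2
  -- The displacement (y, -x) is opposite to the gradient (-y, x), so a small step δ > 0 stays in
  -- `P` and lowers the function by δ(x² + y²).
  have hc : Continuous fun δ : ℝ => (v.1 + δ * y, v.2 - δ * x) := by fun_prop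
  have h0 : (fun δ : ℝ => (v.1 + δ * y, v.2 - δ * x)) ⁻¹' interior P ∈ nhds (0 : ℝ) :=
    hc.continuousAt.preimage_mem_nhds (isOpen_interior.mem_nhds (by simpa using hv))
  obtain ⟨δ, hδ, hδ0⟩ :=
    (Filter.nonempty_of_mem (Filter.inter_mem
      (nhdsWithin_le_nhds h0 : _ ∈ nhdsWithin (0 : ℝ) (Set.Ioi 0)) self_mem_nhdsWithin))
  have h1 := h _ (interior_subset hδ)
  have h2 : orientReal a b (v.1 + δ * y, v.2 - δ * x) =
      orientReal a b v - δ * (x ^ 2 + y ^ 2) := by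
    simp only [orientReal, x, y]; ring
  have hxy : 0 < x ^ 2 + y ^ 2 := by
    by_contra hn
    have hx : x = 0 := by nlinarith [sq_nonneg x, sq_nonneg y]
    have hy : y = 0 := by nlinarith [sq_nonneg x, sq_nonneg y]
    apply hab
    ext
    · have : (b.1 : ℝ) = a.1 := sub_eq_zero.1 hx
      exact_mod_cast this.symm
    · have : (b.2 : ℝ) = a.2 := sub_eq_zero.1 hy
      exact_mod_cast this.symm
  have h3 : 0 < δ * (x ^ 2 + y ^ 2) := mul_pos hδ0 hxy
  linarith

theorem orientReal_pos_of_mem_interior_latticeHull {S : Set (ℤ × ℤ)} {a b : ℤ × ℤ} (hab : a ≠ b)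
    {k : ℤ} (h : ∀ x ∈ S, k ≤ orient a b x) {p : ℤ × ℤ}
    (hp : latticePt p ∈ interior (latticeHull S)) : k < orient a b p := by
  have := lt_orientReal_of_mem_interior hab
    (fun v hv => le_orientReal_of_mem_latticeHull h hv) hp
  rw [orientReal_latticePt] at this
  exact_mod_cast this

theorem mem_latticeHull_of_orientReal_nonneg {S : Set (ℤ × ℤ)} {a b c : ℤ × ℤ} (ha : a ∈ S)
    (hb : b ∈ S) (hc : c ∈ S) (h : 0 < orient a b c) {v : ℝ × ℝ} (h1 : 0 ≤ orientReal a b v)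
    (h2 : 0 ≤ orientReal b c v) (h3 : 0 ≤ orientReal c a v) : v ∈ latticeHull S := by
  have hD : (0 : ℝ) < orient a b c := by exact_mod_cast h
  set D : ℝ := ((orient a b c : ℤ) : ℝ) with hDdef
  have hDe : D = (b.1 - a.1) * (c.2 - a.2) - (b.2 - a.2) * (c.1 - a.1) := by
    simp [hDdef, orient]
  have hs : orientReal b c v / D + orientReal c a v / D + orientReal a b v / D = 1 := by
    rw [← add_div, ← add_div, div_eq_one_iff_eq hD.ne', hDe]
    simp only [orientReal]; ring
  -- The barycentric coordinates of `v` are the areas of the three subtriangles divided by the total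
  -- area.
  have key := (convex_latticeHull S).sum_mem (t := Finset.univ)
    (w := ![orientReal b c v / D, orientReal c a v / D, orientReal a b v / D])
    (z := ![latticePt a, latticePt b, latticePt c])
    (by
      intro i _
      fin_cases i
      · exact div_nonneg h2 hD.le
      · exact div_nonneg h3 hD.le
      · exact div_nonneg h1 hD.le)
    (by simpa [Fin.sum_univ_three] using hs)
    (by
      intro i _
      fin_cases i
      · exact latticePt_mem_latticeHull ha
      · exact latticePt_mem_latticeHull hb
      · exact latticePt_mem_latticeHull hc)
  convert key using 1
  simp only [Fin.sum_univ_three, Matrix.cons_val_zero, Matrix.cons_val_one, Matrix.cons_val,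
    latticePt]
  ext
  · simp only [Prod.fst_add, Prod.smul_fst, smul_eq_mul]
    field_simp
    rw [hDe]; simp only [orientReal]; ring
  · simp only [Prod.snd_add, Prod.smul_snd, smul_eq_mul]
    field_simp
    rw [hDe]; simp only [orientReal]; ring

theorem latticePt_mem_latticeHull_of_orient {S : Set (ℤ × ℤ)} {a b c p : ℤ × ℤ} (ha : a ∈ S)
    (hb : b ∈ S) (hc : c ∈ S) (h : 0 < orient a b c) (h1 : 0 ≤ orient a b p)
    (h2 : 0 ≤ orient b c p) (h3 : 0 ≤ orient c a p) : latticePt p ∈ latticeHull S := by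
  refine mem_latticeHull_of_orientReal_nonneg ha hb hc h ?_ ?_ ?_ <;>
    rw [orientReal_latticePt] <;> exact_mod_cast ‹_›

theorem mem_interior_of_orientReal_pos {S : Set (ℤ × ℤ)} {a b c : ℤ × ℤ} (ha : a ∈ S)
    (hb : b ∈ S) (hc : c ∈ S) {v : ℝ × ℝ} (h1 : 0 < orientReal a b v)
    (h2 : 0 < orientReal b c v) (h3 : 0 < orientReal c a v) : v ∈ interior (latticeHull S) := by
  have h : 0 < orient a b c := by
    have : (orient a b c : ℝ) = orientReal a b v + orientReal b c v + orientReal c a v := by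
      simp only [orient, orientReal]; push_cast; ring
    have : (0 : ℝ) < orient a b c := by linarith
    exact_mod_cast this
  have ho : IsOpen {v | 0 < orientReal a b v ∧ 0 < orientReal b c v ∧ 0 < orientReal c a v} :=
    (isOpen_lt continuous_const (continuous_orientReal a b)).inter
      ((isOpen_lt continuous_const (continuous_orientReal b c)).inter
        (isOpen_lt continuous_const (continuous_orientReal c a)))
  refine interior_maximal (fun v hv => ?_) ho ⟨h1, h2, h3⟩
  exact mem_latticeHull_of_orientReal_nonneg ha hb hc h hv.1.le hv.2.1.le hv.2.2.le

theorem latticePt_mem_interior_of_orient {S : Set (ℤ × ℤ)} {a b c p : ℤ × ℤ} (ha : a ∈ S)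
    (hb : b ∈ S) (hc : c ∈ S) (h1 : 0 < orient a b p)
    (h2 : 0 < orient b c p) (h3 : 0 < orient c a p) :
    latticePt p ∈ interior (latticeHull S) := by
  refine mem_interior_of_orientReal_pos ha hb hc ?_ ?_ ?_ <;>
    rw [orientReal_latticePt] <;> exact_mod_cast ‹_›

theorem interior_latticeHull_nonempty {S : Set (ℤ × ℤ)} {a b c : ℤ × ℤ} (ha : a ∈ S)
    (hb : b ∈ S) (hc : c ∈ S) (h : 0 < orient a b c) : (interior (latticeHull S)).Nonempty := by
  have hD : (0 : ℝ) < (orient a b c : ℤ) := by exact_mod_cast h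
  simp only [orient] at hD
  push_cast at hD
  refine ⟨((a.1 + b.1 + c.1) / 3, (a.2 + b.2 + c.2) / 3),
    mem_interior_of_orientReal_pos ha hb hc ?_ ?_ ?_⟩ <;>
    simp only [orientReal] <;> linarith

/-! ### Lattice points at height one. -/

/-- A triangle of height at least two over a primitive edge contains a lattice point at height
one that lies strictly between the edge and the apex. -/
theorem exists_height_one {a b p : ℤ × ℤ} (hg : Int.gcd (b.1 - a.1) (b.2 - a.2) = 1)
    (hp : orient a b p ≤ -2) :
    ∃ q, orient a b q = -1 ∧
      ∃ m ∈ segment ℝ (latticePt a) (latticePt b), latticePt q ∈ openSegment ℝ m (latticePt p) := by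
  -- By Bézout, (dx, dy) and (v, -u) form a lattice basis, in which p - a has coordinates (x, h).
  obtain ⟨u, v, huv⟩ := Int.isCoprime_iff_gcd_eq_one.2 hg
  set dx := b.1 - a.1 with hdx
  set dy := b.2 - a.2 with hdy
  set h := -orient a b p with hh
  set x := u * (p.1 - a.1) + v * (p.2 - a.2) with hx
  have h2 : 2 ≤ h := by omega
  have hp1 : p.1 - a.1 = x * dx + h * v := by
    simp only [hx, hh, orient, ← hdx, ← hdy]; linear_combination (-(p.1 - a.1)) * huv
  have hp2 : p.2 - a.2 = x * dy - h * u := by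
    simp only [hx, hh, orient, ← hdx, ← hdy]; linear_combination (-(p.2 - a.2)) * huv
  -- The ceiling of x / h. The point `q` has coordinates (k, 1), and the line from `p` through it
  -- meets the line ab at parameter (kh - x)/(h - 1), which lies in [0, 1] because 0 ≤ kh - x ≤ h -
  -- 1.
  set k := -((-x) / h) with hk
  have hk1 : x ≤ k * h := by
    have := Int.ediv_mul_le (-x) (show h ≠ 0 by omega)
    rw [hk]; linarith
  have hk2 : k * h ≤ x + h - 1 := by
    have := Int.lt_ediv_add_one_mul_self (-x) (show 0 < h by omega)
    rw [hk]; nlinarith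
  have hhR : (2 : ℝ) ≤ h := by exact_mod_cast h2
  have hk1R : (x : ℝ) ≤ k * h := by exact_mod_cast hk1
  have hk2R : (k : ℝ) * h ≤ x + h - 1 := by exact_mod_cast hk2
  have hp1R : (p.1 : ℝ) = a.1 + x * dx + h * v := by
    have : p.1 = a.1 + x * dx + h * v := by linarith
    exact_mod_cast this
  have hp2R : (p.2 : ℝ) = a.2 + x * dy - h * u := by
    have : p.2 = a.2 + x * dy - h * u := by linarith
    exact_mod_cast this
  have hb1R : (b.1 : ℝ) = a.1 + dx := by simp [hdx]
  have hb2R : (b.2 : ℝ) = a.2 + dy := by simp [hdy]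
  have hh1 : (0 : ℝ) < h - 1 := by linarith
  have hh0 : (0 : ℝ) < h := by linarith
  refine ⟨(a.1 + k * dx + v, a.2 + k * dy - u), ?_, _,
    ⟨(h - 1 - (k * h - x)) / (h - 1), (k * h - x) / (h - 1), ?_, ?_, ?_, rfl⟩,
    (h - 1) / h, 1 / h, ?_, ?_, ?_, ?_⟩
  · simp only [orient, ← hdx, ← hdy]; linear_combination (-1) * huv
  · apply div_nonneg <;> linarith
  · apply div_nonneg <;> linarith
  · field_simp; ring
  · positivity
  · positivity
  · field_simp; ring
  · ext
    · simp only [latticePt, Prod.smul_mk, Prod.mk_add_mk, smul_eq_mul, hp1R, hb1R]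
      push_cast; field_simp; ring
    · simp only [latticePt, Prod.smul_mk, Prod.mk_add_mk, smul_eq_mul, hp2R, hb2R]
      push_cast; field_simp; ring

/-! ### Lattice-convex sets. -/

/-- A set of lattice points containing every lattice point of its convex hull. -/
def IsLatticeConvex (S : Set (ℤ × ℤ)) : Prop := ∀ p, latticePt p ∈ latticeHull S → p ∈ S

theorem IsLatticeConvex.image {S : Set (ℤ × ℤ)} (hS : IsLatticeConvex S) {m : IntAffine}
    (hm : m.IsUnimodular) : IsLatticeConvex (m.apply '' S) := by
  intro p hp
  rw [← image_latticeHull] at hp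
  obtain ⟨v, hv, hvp⟩ := hp
  refine ⟨m.inv.apply p, hS _ ?_, apply_inv_apply hm p⟩
  rwa [← toReal_latticePt, ← hvp, inv_toReal_toReal hm]

theorem isLatticeConvex_interiorLatticePoints {P : Set (ℝ × ℝ)} (hP : Convex ℝ P) :
    IsLatticeConvex (interiorLatticePoints P) := fun _ hp =>
  latticeHull_subset hP.interior (fun _ hq => hq) hp

/-- If `p` were lower, the hull would contain a lattice point at height -1. This point is neither
`p`, which is lower, nor in `S`, which has nonnegative height. -/
theorem neg_one_le_orient_of_isLatticeConvex {S : Set (ℤ × ℤ)} {p a b : ℤ × ℤ}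
    (hS : IsLatticeConvex (insert p S)) (ha : a ∈ S) (hb : b ∈ S)
    (hg : Int.gcd (b.1 - a.1) (b.2 - a.2) = 1) (hpos : ∀ x ∈ S, 0 ≤ orient a b x) :
    -1 ≤ orient a b p := by
  by_contra hlt
  obtain ⟨q, hq, m, hm, hqm⟩ := exists_height_one hg (show orient a b p ≤ -2 by omega)
  have hc := convex_latticeHull (insert p S)
  have hmS : m ∈ latticeHull (insert p S) :=
    hc.segment_subset (latticePt_mem_latticeHull (Set.mem_insert_of_mem _ ha))
      (latticePt_mem_latticeHull (Set.mem_insert_of_mem _ hb)) hm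
  have hqS := hS q (hc.openSegment_subset hmS
    (latticePt_mem_latticeHull (Set.mem_insert _ _)) hqm)
  rcases hqS with rfl | hqS
  · omega
  · have := hpos q hqS
    omega

/-- Here the point at height -1 is strictly between an interior point of `P` and a point of `P`,
hence is itself interior, against `hpos`. -/
theorem neg_one_le_orient_of_mem {P : Set (ℝ × ℝ)} (hP : Convex ℝ P) {p a b : ℤ × ℤ}
    (hp : latticePt p ∈ P) (ha : a ∈ interiorLatticePoints P) (hb : b ∈ interiorLatticePoints P)
    (hg : Int.gcd (b.1 - a.1) (b.2 - a.2) = 1)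
    (hpos : ∀ x ∈ interiorLatticePoints P, 0 ≤ orient a b x) : -1 ≤ orient a b p := by
  by_contra hlt
  obtain ⟨q, hq, m, hm, hqm⟩ := exists_height_one hg (show orient a b p ≤ -2 by omega)
  have hmP : m ∈ interior P := hP.interior.segment_subset ha hb hm
  have hqP := hpos q (hP.openSegment_interior_self_subset_interior hmP hp hqm)
  omega

/-- A lattice-convex set that properly contains another one stays lattice convex after the
removal of a suitable further point. -/
theorem IsLatticeConvex.exists_erase {S T : Finset (ℤ × ℤ)}
    (hS : IsLatticeConvex (S : Set (ℤ × ℤ))) (hT : IsLatticeConvex (T : Set (ℤ × ℤ)))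
    (hST : ¬ S ⊆ T) :
    ∃ v ∈ S, v ∉ T ∧ IsLatticeConvex (S.erase v : Set (ℤ × ℤ)) := by
  have hfin : ∀ U : Finset (ℤ × ℤ), (latticePt '' (U : Set (ℤ × ℤ))).Finite :=
    fun U => U.finite_toSet.image _
  have hcomp : ∀ U : Finset (ℤ × ℤ), IsCompact (latticeHull (U : Set (ℤ × ℤ))) :=
    fun U => (hfin U).isCompact_convexHull (𝕜 := ℝ)
  have hex : ∃ e ∈ (latticeHull (S : Set (ℤ × ℤ))).extremePoints ℝ,
      e ∉ latticePt '' (T : Set (ℤ × ℤ)) := by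
    by_contra hno
    push Not at hno
    apply hST
    intro p hp
    apply hT
    -- Krein–Milman: if all extreme points of the hull of `S` came from `T`, the hull of `S` would
    -- lie in that of `T`, and lattice convexity would give `S ⊆ T`.
    have h1 := closure_convexHull_extremePoints (hcomp S) (convex_latticeHull _)
    have h2 : latticePt p ∈ latticeHull (S : Set (ℤ × ℤ)) := latticePt_mem_latticeHull hp
    rw [← h1] at h2
    exact closure_minimal (convexHull_mono hno) (hcomp T).isClosed h2
  obtain ⟨e, he, heT⟩ := hex
  obtain ⟨v, hv, rfl⟩ := extremePoints_convexHull_subset (𝕜 := ℝ) he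
  refine ⟨v, hv, fun h => heT (Set.mem_image_of_mem _ h), fun p hp => ?_⟩
  have hsub : latticeHull (S.erase v : Set (ℤ × ℤ)) ⊆ latticeHull (S : Set (ℤ × ℤ)) :=
    latticeHull_mono (by exact_mod_cast Finset.erase_subset v S)
  have hpS := hS p (hsub hp)
  simp only [Finset.mem_coe, Finset.mem_erase]
  refine ⟨?_, hpS⟩
  rintro rfl
  -- An extreme point still present in the smaller hull is extreme there too, so it would be one of
  -- the remaining points.
  have := extremePoints_convexHull_subset (𝕜 := ℝ)
    (inter_extremePoints_subset_extremePoints_of_subset hsub ⟨hp, he⟩)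
  obtain ⟨q, hq, hqp⟩ := this
  rw [latticePt_injective hqp] at hq
  simp at hq

/-- The vertices of the standard unimodular triangle. -/
def standardTriangle : Finset (ℤ × ℤ) := {(0, 0), (1, 0), (0, 1)}

theorem isLatticeConvex_standardTriangle :
    IsLatticeConvex (standardTriangle : Set (ℤ × ℤ)) := by
  intro p hp
  have h : ∀ a b : ℤ × ℤ, (∀ x ∈ standardTriangle, 0 ≤ orient a b x) → 0 ≤ orient a b p := by
    intro a b hab
    have := le_orientReal_of_mem_latticeHull (k := 0) (fun x hx => hab x (by exact_mod_cast hx)) hp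
    rw [orientReal_latticePt] at this
    exact_mod_cast this
  have h1 := h (0, 0) (1, 0) (by decide)
  have h2 := h (0, 1) (0, 0) (by decide)
  have h3 := h (1, 0) (0, 1) (by decide)
  simp only [orient] at h1 h2 h3
  obtain ⟨x, y⟩ := p
  simp only [standardTriangle, Finset.coe_insert, Finset.coe_singleton, Set.mem_insert_iff,
    Set.mem_singleton_iff, Prod.mk.injEq] at *
  omega

theorem IsLatticeConvex.exists_unimodular_triangle {S : Set (ℤ × ℤ)} (hS : IsLatticeConvex S)
    {a b c : ℤ × ℤ} (ha : a ∈ S) (hb : b ∈ S) (hc : c ∈ S) (h : orient a b c ≠ 0) :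
    ∃ a ∈ S, ∃ b ∈ S, ∃ c ∈ S, orient a b c = 1 ∨ orient a b c = -1 := by
  have hconv := convex_latticeHull S
  -- Dividing b - a by its gcd replaces `b` by the lattice point of the segment ab next to `a`,
  -- which makes the edge primitive.
  obtain ⟨b', hb', hg, h'⟩ : ∃ b' ∈ S, Int.gcd (b'.1 - a.1) (b'.2 - a.2) = 1 ∧
      orient a b' c ≠ 0 := by
    have hpos : 0 < Int.gcd (b.1 - a.1) (b.2 - a.2) := by
      rw [Int.gcd_pos_iff]
      by_contra! hn
      apply h
      simp [orient, hn.1, hn.2]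
    obtain ⟨x, y, hxy, hx, hy⟩ := Int.exists_gcd_one hpos
    set g := Int.gcd (b.1 - a.1) (b.2 - a.2)
    have hgR : (1 : ℝ) ≤ g := by exact_mod_cast hpos
    refine ⟨(a.1 + x, a.2 + y), hS _ ?_, by simpa using hxy, fun h0 => h ?_⟩
    · refine hconv.segment_subset (latticePt_mem_latticeHull ha) (latticePt_mem_latticeHull hb)
        ⟨1 - 1 / g, 1 / g, ?_, by positivity, by ring, ?_⟩
      · rw [sub_nonneg, div_le_one (by linarith)]; exact hgR
      · have hb1 : (b.1 : ℝ) = a.1 + x * g := by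
          have : b.1 = a.1 + x * g := by linarith
          exact_mod_cast this
        have hb2 : (b.2 : ℝ) = a.2 + y * g := by
          have : b.2 = a.2 + y * g := by linarith
          exact_mod_cast this
        ext
        · simp only [latticePt, Prod.smul_mk, Prod.mk_add_mk, smul_eq_mul, hb1]
          push_cast; field_simp; ring
        · simp only [latticePt, Prod.smul_mk, Prod.mk_add_mk, smul_eq_mul, hb2]
          push_cast; field_simp; ring
    · simp only [orient] at h0 ⊢
      rw [hx, hy]
      linear_combination (g : ℤ) * h0
  by_cases h1 : orient a b' c = 1 ∨ orient a b' c = -1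
  · exact ⟨a, ha, b', hb', c, hc, h1⟩
  have key : ∀ a ∈ S, ∀ b ∈ S, Int.gcd (b.1 - a.1) (b.2 - a.2) = 1 → orient a b c ≤ -2 →
      ∃ a ∈ S, ∃ b ∈ S, ∃ c ∈ S, orient a b c = 1 ∨ orient a b c = -1 := by
    intro a ha b hb hg h2
    obtain ⟨q, hq, m, hm, hqm⟩ := exists_height_one hg h2
    refine ⟨a, ha, b, hb, q, hS q ?_, Or.inr hq⟩
    exact hconv.openSegment_subset (hconv.segment_subset (latticePt_mem_latticeHull ha)
      (latticePt_mem_latticeHull hb) hm) (latticePt_mem_latticeHull hc) hqm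
  rcases lt_or_gt_of_ne h' with hlt | hgt
  · exact key a ha b' hb' hg (by omega)
  · refine key b' hb' a ha ?_ ?_
    · rw [← hg, ← Int.gcd_neg, ← Int.neg_gcd, neg_sub, neg_sub]
    · have : orient b' a c = -orient a b' c := by simp only [orient]; ring
      omega

/-- A lattice-convex set that is not contained in a line is equivalent to one that contains the
standard triangle. -/
theorem IsLatticeConvex.exists_standardTriangle_subset {S : Finset (ℤ × ℤ)}
    (hS : IsLatticeConvex (S : Set (ℤ × ℤ)))
    (h : ∃ a ∈ S, ∃ b ∈ S, ∃ c ∈ S, orient a b c ≠ 0) :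
    ∃ m : IntAffine, m.IsUnimodular ∧ standardTriangle ⊆ S.image m.apply := by
  obtain ⟨a, ha, b, hb, c, hc, h⟩ := h
  obtain ⟨a, ha, b, hb, c, hc, h⟩ := hS.exists_unimodular_triangle ha hb hc h
  let n : IntAffine := ⟨b.1 - a.1, c.1 - a.1, b.2 - a.2, c.2 - a.2, a.1, a.2⟩
  have hn : n.IsUnimodular := by
    have : n.det = orient a b c := by simp only [IntAffine.det, n, orient]; ring
    rwa [IsUnimodular, this]
  have h0 : n.apply (0, 0) = a := by simp [apply, n]
  have h1 : n.apply (1, 0) = b := by simp [apply, n]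
  have h2 : n.apply (0, 1) = c := by simp [apply, n]
  refine ⟨n.inv, hn.inv, fun p hp => ?_⟩
  rw [Finset.mem_image]
  refine ⟨n.apply p, ?_, inv_apply_apply hn p⟩
  simp only [standardTriangle, Finset.mem_insert, Finset.mem_singleton] at hp
  rcases hp with rfl | rfl | rfl
  · rwa [h0]
  · rwa [h1]
  · rwa [h2]

theorem exists_orient_ne_zero {S : Set (ℤ × ℤ)} (h : (interior (latticeHull S)).Nonempty) :
    ∃ a ∈ S, ∃ b ∈ S, ∃ c ∈ S, orient a b c ≠ 0 := by
  obtain ⟨v, hv⟩ := h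
  by_contra! hno
  have hline : ∀ a b : ℤ × ℤ, a ≠ b → ∃ x ∈ S, orient a b x ≠ 0 := by
    intro a b hab
    by_contra! hx
    have h1 := lt_orientReal_of_mem_interior hab
      (fun v hv => le_orientReal_of_mem_latticeHull (k := 0) (fun x hxS => (hx x hxS).ge) hv) hv
    have hx' : ∀ x ∈ S, orient b a x = 0 := fun x hxS => by
      have : orient b a x = -orient a b x := by simp only [orient]; ring
      rw [this, hx x hxS, neg_zero]
    have h2 := lt_orientReal_of_mem_interior hab.symm
      (fun v hv => le_orientReal_of_mem_latticeHull (k := 0) (fun x hxS => (hx' x hxS).ge) hv) hv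
    have h3 : orientReal b a v = -orientReal a b v := by simp only [orientReal]; ring
    rw [h3] at h2
    push_cast at h1 h2
    linarith
  -- The line is arbitrary; only the existence of a point of `S` is needed.
  obtain ⟨a, ha, -⟩ := hline (0, 0) (1, 0) (by simp)
  by_cases hS : ∃ b ∈ S, a ≠ b
  · obtain ⟨b, hb, hab⟩ := hS
    obtain ⟨x, hx, hx0⟩ := hline a b hab
    exact hx0 (hno a ha b hb x hx)
  · push Not at hS
    -- If `S` were the single point `a`, it would lie on the horizontal line through `a`.
    obtain ⟨x, hx, hx0⟩ := hline a (a.1 + 1, a.2) (by simp [Prod.ext_iff])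
    rw [← hS x hx] at hx0
    simp [orient] at hx0

/-! ### Finite search for points of height at least -1. -/

/-- The primitive segments that support a list of lattice points on their left. -/
def supportingSegments (R : List (ℤ × ℤ)) : List ((ℤ × ℤ) × (ℤ × ℤ)) :=
  (R ×ˢ R).filter fun e =>
    decide (Int.gcd (e.2.1 - e.1.1) (e.2.2 - e.1.2) = 1 ∧ ∀ x ∈ R, 0 ≤ orient e.1 e.2 x)

theorem mem_supportingSegments {R : List (ℤ × ℤ)} {e : (ℤ × ℤ) × (ℤ × ℤ)}
    (he : e ∈ supportingSegments R) : e.1 ∈ R ∧ e.2 ∈ R ∧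
      Int.gcd (e.2.1 - e.1.1) (e.2.2 - e.1.2) = 1 ∧ ∀ x ∈ R, 0 ≤ orient e.1 e.2 x := by
  rw [supportingSegments, List.mem_filter, decide_eq_true_iff] at he
  exact ⟨(List.pair_mem_product.1 he.1).1, (List.pair_mem_product.1 he.1).2, he.2⟩

/-- The lattice points of the square `[0, B]²`. -/
def latticeBox (B : ℕ) : List (ℤ × ℤ) :=
  (List.range (B + 1)).flatMap fun i : ℕ => (List.range (B + 1)).map fun j : ℕ => ((i : ℤ), (j : ℤ))

theorem mem_latticeBox {B : ℕ} {p : ℤ × ℤ} (h1 : 0 ≤ p.1) (h2 : p.1 ≤ B) (h3 : 0 ≤ p.2)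
    (h4 : p.2 ≤ B) : p ∈ latticeBox B := by
  simp only [latticeBox, List.mem_flatMap, List.mem_map, List.mem_range]
  exact ⟨p.1.toNat, by omega, p.2.toNat, by omega, by ext <;> simp [h1, h3]⟩

/-- The points of `[0, B]²` that lie at height at least `-1` over every segment of the list. -/
def relaxation (B : ℕ) (E : List ((ℤ × ℤ) × (ℤ × ℤ))) : List (ℤ × ℤ) :=
  (latticeBox B).filter fun p => decide (∀ e ∈ E, -1 ≤ orient e.1 e.2 p)

/-- Two of the constraints `-1 ≤ orient e.1 e.2 p` have a nonnegative combination that bounds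
`u * p.1 + w * p.2` below by `c`. -/
def BoundsBelow (E : List ((ℤ × ℤ) × (ℤ × ℤ))) (u w c : ℤ) : Prop :=
  ∃ e ∈ E, ∃ f ∈ E,
    0 ≤ u * (f.2.1 - f.1.1) + w * (f.2.2 - f.1.2) ∧
    0 ≤ -(e.2.2 - e.1.2) * w - (e.2.1 - e.1.1) * u ∧
    0 < orient (0, 0) (e.2.1 - e.1.1, e.2.2 - e.1.2) (f.2.1 - f.1.1, f.2.2 - f.1.2) ∧
    orient (0, 0) (e.2.1 - e.1.1, e.2.2 - e.1.2) (f.2.1 - f.1.1, f.2.2 - f.1.2) * (c - 1) <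
      (u * (f.2.1 - f.1.1) + w * (f.2.2 - f.1.2)) * (-1 - orient e.1 e.2 (0, 0)) +
      (-(e.2.2 - e.1.2) * w - (e.2.1 - e.1.1) * u) * (-1 - orient f.1 f.2 (0, 0))

instance (E : List ((ℤ × ℤ) × (ℤ × ℤ))) (u w c : ℤ) : Decidable (BoundsBelow E u w c) := by
  unfold BoundsBelow; infer_instance

/-- A Farkas certificate. By Cramer's rule the two coefficients combine the linear parts of the
constraints into `m` times the form (u, w). The certificate only has to exceed c - 1 strictly, since
the form takes integer values at `p`. -/
theorem BoundsBelow.le {E : List ((ℤ × ℤ) × (ℤ × ℤ))} {u w c : ℤ} (h : BoundsBelow E u w c)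
    {p : ℤ × ℤ} (hp : ∀ e ∈ E, -1 ≤ orient e.1 e.2 p) : c ≤ u * p.1 + w * p.2 := by
  obtain ⟨e, he, f, hf, h1, h2, h3, h4⟩ := h
  have he' := mul_le_mul_of_nonneg_left (hp e he) h1
  have hf' := mul_le_mul_of_nonneg_left (hp f hf) h2
  set m := orient (0, 0) (e.2.1 - e.1.1, e.2.2 - e.1.2) (f.2.1 - f.1.1, f.2.2 - f.1.2) with hm
  have key : m * (c - 1) < m * (u * p.1 + w * p.2) := by
    refine h4.trans_le ?_
    simp only [orient] at he' hf' hm ⊢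
    rw [hm]
    linarith
  have := lt_of_mul_lt_mul_left key h3.le
  omega

/-- The constraints `-1 ≤ orient e.1 e.2 p` confine `p` to the square `[0, B]²`. -/
def ConfinedTo (B : ℕ) (E : List ((ℤ × ℤ) × (ℤ × ℤ))) : Prop :=
  BoundsBelow E 1 0 0 ∧ BoundsBelow E (-1) 0 (-B) ∧ BoundsBelow E 0 1 0 ∧
    BoundsBelow E 0 (-1) (-B)

instance (B : ℕ) (E : List ((ℤ × ℤ) × (ℤ × ℤ))) : Decidable (ConfinedTo B E) := by
  unfold ConfinedTo; infer_instance

theorem ConfinedTo.mem_relaxation {B : ℕ} {E : List ((ℤ × ℤ) × (ℤ × ℤ))} (h : ConfinedTo B E)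
    {p : ℤ × ℤ} (hp : ∀ e ∈ E, -1 ≤ orient e.1 e.2 p) : p ∈ relaxation B E := by
  obtain ⟨h1, h2, h3, h4⟩ := h
  have h1 := h1.le hp
  have h2 := h2.le hp
  have h3 := h3.le hp
  have h4 := h4.le hp
  rw [relaxation, List.mem_filter]
  exact ⟨mem_latticeBox (by omega) (by omega) (by omega) (by omega), by simpa using hp⟩

theorem neg_one_le_orient_of_mem_relaxation {B : ℕ} {E : List ((ℤ × ℤ) × (ℤ × ℤ))} {p : ℤ × ℤ}
    (hp : p ∈ relaxation B E) : ∀ e ∈ E, -1 ≤ orient e.1 e.2 p := by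
  simpa using (List.mem_filter.1 hp).2

/-! ### Classification by one-point extensions. -/

/-- Every lattice-convex set of cardinality `n` that contains the standard triangle is equivalent
to a set of the list. -/
def Classifies (n : ℕ) (L : List (List (ℤ × ℤ))) : Prop :=
  ∀ S : Finset (ℤ × ℤ), IsLatticeConvex (S : Set (ℤ × ℤ)) → standardTriangle ⊆ S → S.card = n →
    ∃ m : IntAffine, m.IsUnimodular ∧ ∃ R ∈ L, S.image m.apply = R.toFinset

instance (m : IntAffine) : Decidable m.IsUnimodular := by
  unfold IsUnimodular; infer_instance

/-- Every extension by one point of a set of `L` is equivalent to a set of `L'`, by means of one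
of the maps attached to the set that is extended. -/
def ExtendsTo (B n : ℕ) (L : List (List (ℤ × ℤ) × List IntAffine)) (L' : List (List (ℤ × ℤ))) :
    Prop :=
  (∀ R ∈ L', R.length ≤ n + 1) ∧
  ∀ R ∈ L, ConfinedTo B (supportingSegments R.1) ∧
    ∀ p ∈ relaxation B (supportingSegments R.1), p ∈ R.1 ∨ ∃ m ∈ R.2, m.IsUnimodular ∧
      ∃ R' ∈ L', ∀ x ∈ p :: R.1, m.apply x ∈ R'

instance (B n : ℕ) (L : List (List (ℤ × ℤ) × List IntAffine)) (L' : List (List (ℤ × ℤ))) :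
    Decidable (ExtendsTo B n L L') := by
  unfold ExtendsTo; infer_instance

theorem Classifies.extend {B n : ℕ} (hn : 3 ≤ n) {L : List (List (ℤ × ℤ) × List IntAffine)}
    {L' : List (List (ℤ × ℤ))} (hL : Classifies n (L.map Prod.fst)) (h : ExtendsTo B n L L') :
    Classifies (n + 1) L' := by
  intro S hS hT hcard
  -- The removed point avoids the standard triangle, so the remaining set satisfies the hypotheses
  -- of `hL`.
  obtain ⟨v, hv, hvT, hSv⟩ := hS.exists_erase isLatticeConvex_standardTriangle fun hsub => by
    have := Finset.card_le_card hsub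
    have h3 : standardTriangle.card = 3 := rfl
    omega
  have hTv : standardTriangle ⊆ S.erase v := fun p hp => by
    rw [Finset.mem_erase]
    exact ⟨fun hpv => hvT (hpv ▸ hp), hT hp⟩
  obtain ⟨m, hm, R₁, hR₁, hmR⟩ := hL _ hSv hTv (by rw [Finset.card_erase_of_mem hv, hcard]; rfl)
  obtain ⟨R, hR, rfl⟩ := List.mem_map.1 hR₁
  obtain ⟨hbox, hext⟩ := h.2 R hR
  have himage : S.image m.apply = insert (m.apply v) R.1.toFinset := by
    rw [← hmR, ← Finset.image_insert, Finset.insert_erase hv]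
  have hnot : m.apply v ∉ R.1.toFinset := by
    rw [← hmR, Finset.mem_image]
    rintro ⟨q, hq, hqv⟩
    rw [apply_injective hm hqv] at hq
    simp at hq
  have hconv : IsLatticeConvex (insert (m.apply v) (R.1.toFinset : Set (ℤ × ℤ))) := by
    have := hS.image hm
    rwa [← Finset.coe_image, himage, Finset.coe_insert] at this
  have hmem : m.apply v ∈ relaxation B (supportingSegments R.1) := by
    refine hbox.mem_relaxation fun e he => ?_
    obtain ⟨h1, h2, h3, h4⟩ := mem_supportingSegments he
    exact neg_one_le_orient_of_isLatticeConvex hconv (by simpa using h1) (by simpa using h2) h3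
      (by simpa using h4)
  rcases hext _ hmem with hR' | ⟨m', -, hm', R', hR', hsub⟩
  · exact absurd (List.mem_toFinset.2 hR') hnot
  · refine ⟨m'.comp m, hm'.comp hm, R', hR', ?_⟩
    have hcomp : S.image (m'.comp m).apply = (S.image m.apply).image m'.apply := by
      rw [Finset.image_image]
      congr 1
      funext p
      exact comp_apply _ _ _
    -- `ExtendsTo` tests only inclusion in `R'`; its length bound turns this into equality.
    apply Finset.eq_of_subset_of_card_le
    · rw [hcomp, himage]
      intro q hq
      obtain ⟨x, hx, rfl⟩ := Finset.mem_image.1 hq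
      rw [List.mem_toFinset]
      exact hsub x (by simpa using hx)
    · rw [Finset.card_image_of_injective _ (apply_injective (hm'.comp hm)), hcard]
      exact (List.toFinset_card_le _).trans (h.1 R' hR')

/-- The translation by (1, 1) puts the relaxation, the triangle x ≥ 0, y ≥ 0, x + y ≤ 4, into the
box. -/
theorem classifies_three : Classifies 3 [[(1, 1), (2, 1), (1, 2)]] := by
  intro S _ hT hcard
  have hS : standardTriangle = S := Finset.eq_of_subset_of_card_le hT hcard.le
  subst hS
  exact ⟨⟨1, 0, 0, 1, 1, 1⟩, Or.inl rfl, _, List.mem_singleton_self _, by decide⟩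

/-! ### From interior lattice points to polygons. -/

/-- The lattice points on the left of all segments that support `R` are those of `R`, and the
relaxation of `R` is the set of lattice points of a polygon with vertices in `V` whose interior
lattice points are those of `R`. -/
def IsRelaxedHull (B : ℕ) (R V : List (ℤ × ℤ)) : Prop :=
  ConfinedTo B (supportingSegments R) ∧
  (∃ a ∈ R, ∃ b ∈ R, ∃ c ∈ R, 0 < orient a b c) ∧
  (∀ v ∈ V, v ∈ relaxation B (supportingSegments R)) ∧
  (∀ p ∈ relaxation B (supportingSegments R), ∃ a ∈ V, ∃ b ∈ V, ∃ c ∈ V, 0 < orient a b c ∧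
    0 ≤ orient a b p ∧ 0 ≤ orient b c p ∧ 0 ≤ orient c a p) ∧
  (∀ p ∈ R, ∃ a ∈ relaxation B (supportingSegments R), ∃ b ∈ relaxation B (supportingSegments R),
    0 < orient a b p ∧ ∃ c ∈ relaxation B (supportingSegments R),
      0 < orient b c p ∧ 0 < orient c a p) ∧
  (∀ p ∈ relaxation B (supportingSegments R),
    (∀ e ∈ supportingSegments R, 0 ≤ orient e.1 e.2 p) → p ∈ R)

instance (B : ℕ) (R V : List (ℤ × ℤ)) : Decidable (IsRelaxedHull B R V) := by
  unfold IsRelaxedHull; infer_instance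

/-- Some point of `R` is on the boundary of the convex hull of the relaxation of `R`. -/
def IsObstructed (B : ℕ) (R : List (ℤ × ℤ)) : Prop :=
  ConfinedTo B (supportingSegments R) ∧
  ∃ a ∈ relaxation B (supportingSegments R), ∃ b ∈ relaxation B (supportingSegments R), a ≠ b ∧
    (∀ x ∈ relaxation B (supportingSegments R), 0 ≤ orient a b x) ∧ ∃ p ∈ R, orient a b p ≤ 0

instance (B : ℕ) (R : List (ℤ × ℤ)) : Decidable (IsObstructed B R) := by
  unfold IsObstructed; infer_instance

theorem IsLatticePolygon.convex {P : Set (ℝ × ℝ)} (hP : IsLatticePolygon P) : Convex ℝ P := by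
  obtain ⟨⟨S, rfl⟩, -⟩ := hP
  exact convex_latticeHull _

theorem IsLatticePolygon.subset_relaxation {B : ℕ} {R : List (ℤ × ℤ)} {P : Set (ℝ × ℝ)}
    (hR : ConfinedTo B (supportingSegments R)) (hP : IsLatticePolygon P)
    (hi : interiorLatticePoints P = {p | p ∈ R}) :
    P ⊆ latticeHull {p | p ∈ relaxation B (supportingSegments R)} := by
  have hconv := hP.convex
  obtain ⟨⟨S, rfl⟩, -⟩ := hP
  refine latticeHull_mono fun p hp => hR.mem_relaxation fun e he => ?_
  obtain ⟨h1, h2, h3, h4⟩ := mem_supportingSegments he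
  exact neg_one_le_orient_of_mem hconv (latticePt_mem_latticeHull hp) (by rw [hi]; exact h1)
    (by rw [hi]; exact h2) h3 (by rw [hi]; exact h4)

/-- Any such polygon lies in the hull of the relaxation, and a boundary point of the larger set
cannot be interior to the smaller one. -/
theorem IsObstructed.interiorLatticePoints_ne {B : ℕ} {R : List (ℤ × ℤ)} (hR : IsObstructed B R)
    {P : Set (ℝ × ℝ)} (hP : IsLatticePolygon P) : interiorLatticePoints P ≠ {p | p ∈ R} := by
  intro hi
  obtain ⟨hbox, a, -, b, -, hab, hpos, p, hp, hp0⟩ := hR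
  have hpP : p ∈ interiorLatticePoints P := by rw [hi]; exact hp
  have := orientReal_pos_of_mem_interior_latticeHull hab hpos
    (interior_mono (hP.subset_relaxation hbox hi) hpP)
  omega

/-- The interior of a convex set is convex, so the interior polygon adds no lattice points. -/
theorem interiorLatticePoints_eq_of_interiorPolygon_eq {P Q : Set (ℝ × ℝ)} (hP : Convex ℝ P)
    (hQ : Convex ℝ Q) (h : interiorPolygon P = interiorPolygon Q) :
    interiorLatticePoints P = interiorLatticePoints Q := by
  have hsub : ∀ {P Q : Set (ℝ × ℝ)}, Convex ℝ Q → interiorPolygon P = interiorPolygon Q →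
      interiorLatticePoints P ⊆ interiorLatticePoints Q := fun hQ h p hp => by
    apply isLatticeConvex_interiorLatticePoints hQ
    change latticePt p ∈ interiorPolygon _
    rw [← h]
    exact latticePt_mem_latticeHull hp
  exact (hsub hQ h).antisymm (hsub hP h.symm)

namespace IsRelaxedHull

variable {B : ℕ} {R V : List (ℤ × ℤ)}

theorem latticeHull_eq (h : IsRelaxedHull B R V) :
    latticeHull {p | p ∈ V} = latticeHull {p | p ∈ relaxation B (supportingSegments R)} := by
  obtain ⟨-, -, hV, hM, -, -⟩ := h
  refine (latticeHull_mono hV).antisymm (latticeHull_subset (convex_latticeHull _) fun p hp => ?_)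
  obtain ⟨a, ha, b, hb, c, hc, h, h1, h2, h3⟩ := hM p hp
  exact latticePt_mem_latticeHull_of_orient ha hb hc h h1 h2 h3

theorem interiorLatticePoints_eq (h : IsRelaxedHull B R V) :
    interiorLatticePoints (latticeHull {p | p ∈ V}) = {p | p ∈ R} := by
  rw [h.latticeHull_eq]
  obtain ⟨hbox, -, -, -, hR, hcore⟩ := h
  ext p
  constructor
  · intro hp
    have hpos : ∀ e ∈ supportingSegments R, 0 ≤ orient e.1 e.2 p := fun e he => by
      have hne : e.1 ≠ e.2 := fun heq => by
        have := (mem_supportingSegments he).2.2.1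
        simp [heq] at this
      -- Interior points have height strictly above -1, hence at least 0 by integrality; the last
      -- clause of `IsRelaxedHull` then puts them in `R`.
      have := orientReal_pos_of_mem_interior_latticeHull hne
        (fun x hx => neg_one_le_orient_of_mem_relaxation hx e he) hp
      omega
    exact hcore p (hbox.mem_relaxation fun e he => by have := hpos e he; omega) hpos
  · intro hp
    obtain ⟨a, ha, b, hb, h1, c, hc, h2, h3⟩ := hR p hp
    exact latticePt_mem_interior_of_orient ha hb hc h1 h2 h3

theorem isLatticePolygon (h : IsRelaxedHull B R V) :
    IsLatticePolygon (latticeHull {p | p ∈ V}) := by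
  refine ⟨⟨V.toFinset, by congr 1; ext; simp⟩, ?_⟩
  obtain ⟨a, ha, -⟩ := h.2.1
  exact ⟨latticePt a, by
    change a ∈ interiorLatticePoints _
    rw [h.interiorLatticePoints_eq]
    exact ha⟩

theorem subset_of_interiorLatticePoints_eq (h : IsRelaxedHull B R V) {P : Set (ℝ × ℝ)}
    (hP : IsLatticePolygon P) (hi : interiorLatticePoints P = {p | p ∈ R}) :
    P ⊆ latticeHull {p | p ∈ V} := by
  rw [h.latticeHull_eq]
  exact hP.subset_relaxation h.1 hi

theorem isMaximalNonhyperelliptic (h : IsRelaxedHull B R V) :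
    IsMaximalNonhyperelliptic R.toFinset.card (latticeHull {p | p ∈ V}) := by
  refine ⟨h.isLatticePolygon, ?_, ?_, ?_⟩
  · rw [latticeGenus, h.interiorLatticePoints_eq, ← List.coe_toFinset, Set.ncard_coe_finset]
  · rw [IsNonhyperelliptic, interiorPolygon, h.interiorLatticePoints_eq]
    obtain ⟨a, ha, b, hb, c, hc, hpos⟩ := h.2.1
    exact interior_latticeHull_nonempty (S := {p | p ∈ R}) ha hb hc hpos
  · rintro ⟨Q, hQ, hss, hi⟩
    refine hss.not_subset (h.subset_of_interiorLatticePoints_eq hQ ?_)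
    rw [← h.interiorLatticePoints_eq]
    exact interiorLatticePoints_eq_of_interiorPolygon_eq hQ.convex h.isLatticePolygon.convex hi

theorem eq_of_isMaximalPolygon (h : IsRelaxedHull B R V) {P : Set (ℝ × ℝ)}
    (hP : IsLatticePolygon P) (hmax : IsMaximalPolygon P)
    (hi : interiorLatticePoints P = {p | p ∈ R}) : P = latticeHull {p | p ∈ V} := by
  by_contra hne
  refine hmax ⟨_, h.isLatticePolygon,
    (h.subset_of_interiorLatticePoints_eq hP hi).ssubset_of_ne hne, ?_⟩
  rw [interiorPolygon, interiorPolygon, h.interiorLatticePoints_eq, hi]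

end IsRelaxedHull

/-! ### Inequivalence, and the criterion for a given genus. -/

/-- The sum of the fourth powers of twice the areas of the triangles spanned by a finite set. -/
def quarticInvariant (S : Finset (ℤ × ℤ)) : ℤ :=
  ∑ a ∈ S, ∑ b ∈ S, ∑ c ∈ S, orient a b c ^ 4

theorem quarticInvariant_image {m : IntAffine} (hm : m.IsUnimodular) (S : Finset (ℤ × ℤ)) :
    quarticInvariant (S.image m.apply) = quarticInvariant S := by
  have hinj := (apply_injective hm).injOn (s := (S : Set (ℤ × ℤ)))
  have h4 : m.det ^ 4 = 1 := by
    linear_combination (m.det ^ 2 + 1) * hm.sq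
  simp only [quarticInvariant, Finset.sum_image hinj, orient_apply, mul_pow, h4, one_mul]

/-- An equivalence carries interior lattice points onto interior lattice points, so comparing the
invariants of these sets suffices. -/
theorem not_latticeEquivalent {B : ℕ} {R V R' V' : List (ℤ × ℤ)} (h : IsRelaxedHull B R V)
    (h' : IsRelaxedHull B R' V')
    (hne : quarticInvariant R.toFinset ≠ quarticInvariant R'.toFinset) :
    ¬ LatticeEquivalent (latticeHull {p | p ∈ V}) (latticeHull {p | p ∈ V'}) := by
  intro heq
  obtain ⟨m, hm, hmV⟩ := latticeEquivalent_iff.1 heq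
  have := interiorLatticePoints_image hm (latticeHull {p | p ∈ V})
  rw [hmV, h.interiorLatticePoints_eq, h'.interiorLatticePoints_eq, ← List.coe_toFinset,
    ← List.coe_toFinset, ← Finset.coe_image, Finset.coe_inj] at this
  rw [this, quarticInvariant_image hm] at hne
  exact hne rfl

theorem isMaximalNonhyperelliptic_iff {B g : ℕ} (hg0 : g ≠ 0)
    {good : List (List (ℤ × ℤ) × List (ℤ × ℤ))}
    {bad : List (List (ℤ × ℤ))} (hclass : Classifies g (good.map Prod.fst ++ bad))
    (hgood : ∀ R ∈ good, IsRelaxedHull B R.1 R.2 ∧ R.1.toFinset.card = g)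
    (hbad : ∀ R ∈ bad, IsObstructed B R) (P : Set (ℝ × ℝ)) :
    IsMaximalNonhyperelliptic g P ↔
      ∃ Q ∈ good.map fun R => latticeHull {p | p ∈ R.2}, LatticeEquivalent P Q := by
  constructor
  · rintro ⟨hP, hg, hnh, hmax⟩
    obtain ⟨a, ha, b, hb, c, hc, habc⟩ := exists_orient_ne_zero hnh
    -- `Set.ncard` is 0 on infinite sets, so a nonzero genus is what gives finiteness.
    have hfin : (interiorLatticePoints P).Finite :=
      Set.finite_of_ncard_ne_zero (by rw [← latticeGenus, hg]; exact hg0)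
    obtain ⟨S, hS⟩ := hfin.exists_finset_coe
    have hconv : IsLatticeConvex (S : Set (ℤ × ℤ)) := by
      rw [hS]; exact isLatticeConvex_interiorLatticePoints hP.convex
    obtain ⟨m, hm, hsub⟩ := hconv.exists_standardTriangle_subset (by
      simp only [← Finset.mem_coe, hS]; exact ⟨a, ha, b, hb, c, hc, habc⟩)
    obtain ⟨n, hn, R, hR, hnR⟩ := hclass (S.image m.apply)
      (by rw [Finset.coe_image]; exact hconv.image hm) hsub
      (by
        rw [Finset.card_image_of_injective _ (apply_injective hm), ← hg, latticeGenus, ← hS,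
          Set.ncard_coe_finset])
    have hnm := hn.comp hm
    have hi : interiorLatticePoints ((n.comp m).toReal '' P) = {p | p ∈ R} := by
      rw [interiorLatticePoints_image hnm, ← hS, ← List.coe_toFinset, ← hnR, Finset.coe_image,
        Finset.coe_image, Set.image_image]
      simp only [comp_apply]
    rcases List.mem_append.1 hR with hR | hR
    · obtain ⟨R, hRg, rfl⟩ := List.mem_map.1 hR
      exact ⟨_, List.mem_map_of_mem hRg, latticeEquivalent_iff.2 ⟨_, hnm,
        (hgood R hRg).1.eq_of_isMaximalPolygon (hP.image hnm) (hmax.image hnm) hi⟩⟩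
    · exact absurd hi ((hbad R hR).interiorLatticePoints_ne (hP.image hnm))
  · rintro ⟨Q, hQ, heq⟩
    obtain ⟨R, hR, rfl⟩ := List.mem_map.1 hQ
    obtain ⟨m, hm, rfl⟩ := latticeEquivalent_iff.1 heq.symm
    obtain ⟨h, rfl⟩ := hgood R hR
    exact h.isMaximalNonhyperelliptic.image hm

/-! ### Tables and their verification. -/

/-- The lattice-convex sets of 3 points, with maps that normalise their one-point extensions. -/
def convexSetsThree : List (List (ℤ × ℤ) × List IntAffine) :=
  [([(1, 1), (2, 1), (1, 2)], [⟨0, 1, 1, 0, 0, 0⟩, ⟨-1, -1, 0, 1, 4, 0⟩, ⟨-1, -1, 1, 0, 4, 0⟩,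
     ⟨1, 0, 0, 1, 0, 0⟩, ⟨0, 1, 1, 0, 1, 1⟩, ⟨0, 1, 1, -1, 0, 2⟩, ⟨1, 0, -1, 1, 0, 2⟩,
     ⟨1, 1, 1, 2, -1, -2⟩, ⟨1, 1, 2, 1, -1, -2⟩])]

/-- The lattice-convex sets of 4 points, with maps that normalise their one-point extensions. -/
def convexSetsFour : List (List (ℤ × ℤ) × List IntAffine) :=
  [([(1, 1), (2, 2), (2, 3), (3, 2)], [⟨0, 1, 1, 0, -1, -1⟩, ⟨1, 0, 0, 1, -1, -1⟩,
     ⟨-1, 1, 0, 1, 2, 0⟩, ⟨1, -1, 1, 0, 2, 0⟩, ⟨-1, 1, -1, 0, 1, 3⟩, ⟨-1, 0, 0, -1, 4, 4⟩]),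
   ([(1, 1), (1, 2), (1, 3), (2, 1)], [⟨1, 0, 0, 1, 0, 0⟩, ⟨1, 0, -2, -1, 0, 6⟩,
     ⟨0, 1, 1, 1, 0, -1⟩, ⟨0, 1, 1, 0, 0, 1⟩, ⟨1, 0, 1, 1, 0, -1⟩, ⟨-2, -1, 1, 0, 6, 1⟩,
     ⟨-2, -1, -1, -1, 6, 5⟩]),
   ([(1, 1), (1, 2), (2, 1), (2, 2)], [⟨0, 1, 1, 0, 0, 0⟩, ⟨-1, 0, 0, 1, 3, 0⟩,
     ⟨0, -1, 1, 0, 3, 0⟩, ⟨-1, 0, 0, -1, 3, 3⟩, ⟨1, 0, 0, 1, 0, 0⟩, ⟨0, 1, -1, 0, 0, 3⟩,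
     ⟨1, 0, -1, 1, 0, 2⟩, ⟨0, -1, 1, 1, 3, -1⟩])]

/-- The lattice-convex sets of 5 points, with maps that normalise their one-point extensions. -/
def convexSetsFive : List (List (ℤ × ℤ) × List IntAffine) :=
  [([(0, 0), (1, 1), (1, 2), (1, 3), (2, 1)], [⟨1, 0, 0, 1, 0, 0⟩, ⟨1, 0, 0, 1, 0, 1⟩,
     ⟨-1, 0, -1, 1, 2, 1⟩]),
   ([(1, 1), (1, 2), (2, 1), (2, 2), (3, 3)], [⟨-1, 1, 0, 1, 1, 0⟩, ⟨-1, 1, 0, 1, 2, 0⟩,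
     ⟨0, 1, 1, -1, 0, 2⟩, ⟨1, -1, 1, 0, 2, 0⟩, ⟨1, 0, -1, 1, 0, 2⟩, ⟨-1, 1, -1, 2, 1, 1⟩,
     ⟨-1, 0, 0, -1, 3, 3⟩, ⟨0, -1, -1, 0, 3, 3⟩]),
   ([(1, 1), (1, 2), (1, 3), (2, 2), (3, 2)], [⟨0, 1, 1, 0, -1, 0⟩, ⟨1, 0, 0, 1, 0, 0⟩,
     ⟨1, 0, -1, 1, 0, 1⟩, ⟨0, 1, 1, 1, -1, -1⟩, ⟨0, 1, 1, 1, -1, -2⟩, ⟨1, 0, 0, -1, 0, 4⟩,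
     ⟨0, -1, 1, -1, 3, 2⟩]),
   ([(1, 1), (1, 2), (2, 2), (3, 2), (3, 3)], [⟨0, 1, 1, 0, -1, 0⟩, ⟨1, -1, 1, 0, 1, 0⟩,
     ⟨-1, 1, 0, 1, 2, 0⟩, ⟨0, 1, -1, 2, -1, 0⟩, ⟨0, 1, 1, -1, 0, 2⟩, ⟨-1, 1, -1, 0, 1, 4⟩,
     ⟨-1, 1, 0, -1, 2, 4⟩, ⟨0, -1, 1, -1, 4, 2⟩]),
   ([(1, 1), (1, 2), (1, 3), (1, 4), (2, 1)], [⟨-1, 0, 0, 1, 2, 0⟩, ⟨1, 0, -3, -1, 0, 8⟩,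
     ⟨1, 0, 0, 1, 0, 0⟩, ⟨-1, 0, -3, -1, 2, 8⟩, ⟨0, 1, 1, 0, 0, 0⟩, ⟨1, 1, 1, 0, -1, 0⟩]),
   ([(1, 1), (1, 2), (1, 3), (2, 1), (2, 2)], [⟨0, 1, 1, 0, 0, 0⟩, ⟨-1, -1, -1, 0, 5, 3⟩,
     ⟨1, 0, 0, 1, 0, 0⟩, ⟨0, 1, -1, 0, 0, 3⟩, ⟨1, 0, -1, -1, 0, 5⟩, ⟨-1, 1, 1, 0, 2, 0⟩])]

/-- The sets of interior lattice points of the polygons of genus 6, with the vertices of these. -/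
def genusSixData : List (List (ℤ × ℤ) × List (ℤ × ℤ)) :=
  [([(1, 1), (1, 2), (1, 3), (2, 1), (2, 2), (3, 1)], [(0, 0), (5, 0), (0, 5)]),
   ([(1, 1), (1, 2), (2, 1), (2, 2), (3, 1), (3, 2)], [(0, 0), (4, 0), (4, 3), (0, 3)]),
   ([(1, 1), (1, 2), (2, 1), (2, 2), (3, 1), (4, 1)], [(0, 0), (7, 0), (1, 3), (0, 3)]),
   ([(1, 1), (1, 2), (1, 3), (2, 1), (2, 2), (3, 2)], [(0, 0), (2, 0), (4, 2), (0, 4)]),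
   ([(1, 1), (1, 2), (2, 1), (2, 2), (2, 3), (3, 2)], [(0, 0), (2, 0), (4, 2), (2, 4), (0, 2)])]

/-- The lattice-convex sets of 6 points that are not the interior points of a polygon. -/
def obstructedSetsSix : List (List (ℤ × ℤ)) :=
  [[(0, 0), (1, 1), (1, 2), (1, 3), (2, 1), (2, 2)],
   [(0, 1), (1, 1), (1, 2), (1, 3), (1, 4), (2, 2)],
   [(0, 0), (1, 1), (1, 2), (1, 3), (1, 4), (2, 1)],
   [(0, 1), (1, 1), (1, 2), (1, 3), (1, 4), (2, 4)],
   [(0, 1), (1, 1), (1, 2), (1, 3), (2, 1), (3, 0)],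
   [(0, 1), (1, 1), (1, 2), (1, 3), (1, 4), (2, 3)],
   [(0, 1), (1, 1), (1, 2), (1, 3), (1, 4), (2, 1)],
   [(1, 1), (1, 2), (1, 3), (1, 4), (1, 5), (2, 1)]]

/-- The sets of interior lattice points of the polygons of genus 7, with the vertices of these. -/
def genusSevenData : List (List (ℤ × ℤ) × List (ℤ × ℤ)) :=
  [([(1, 1), (1, 2), (2, 1), (2, 2), (3, 1), (3, 2), (4, 1)], [(0, 0), (6, 0), (3, 3), (0, 3)]),
   ([(1, 1), (1, 2), (2, 1), (2, 2), (3, 1), (4, 1), (5, 1)], [(0, 0), (9, 0), (0, 3)]),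
   ([(1, 1), (2, 1), (2, 2), (2, 3), (3, 2), (3, 3), (4, 2)], [(0, 0), (1, 0), (5, 2), (3, 4),
     (2, 4)]),
   ([(1, 1), (1, 2), (1, 3), (1, 4), (2, 1), (2, 2), (3, 1)], [(0, 0), (4, 0), (0, 6)]),
   ([(1, 1), (1, 2), (1, 3), (2, 1), (2, 2), (2, 3), (3, 3)], [(0, 0), (2, 0), (4, 4), (0, 4)]),
   ([(1, 1), (1, 2), (1, 3), (2, 1), (2, 2), (2, 3), (3, 2)], [(0, 0), (2, 0), (4, 2), (2, 4),
     (0, 4)]),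
   ([(1, 1), (1, 2), (2, 1), (2, 2), (2, 3), (3, 2), (3, 3)], [(0, 0), (2, 0), (4, 2), (4, 4),
     (2, 4), (0, 2)])]

/-- The lattice-convex sets of 7 points that are not the interior points of a polygon. -/
def obstructedSetsSeven : List (List (ℤ × ℤ)) :=
  [[(0, 0), (1, 1), (1, 2), (1, 3), (2, 1), (2, 2), (3, 1)],
   [(1, 1), (1, 2), (1, 3), (2, 1), (2, 2), (2, 3), (3, 4)],
   [(0, 0), (1, 1), (1, 2), (1, 3), (1, 4), (2, 1), (2, 2)],
   [(0, 1), (1, 1), (1, 2), (1, 3), (1, 4), (2, 1), (2, 2)],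
   [(0, 2), (1, 1), (1, 2), (1, 3), (1, 4), (2, 1), (2, 2)],
   [(0, 3), (1, 1), (1, 2), (1, 3), (1, 4), (2, 1), (2, 2)],
   [(0, 0), (1, 1), (1, 2), (1, 3), (2, 1), (2, 2), (3, 2)],
   [(0, 1), (1, 1), (1, 2), (1, 3), (1, 4), (1, 5), (2, 4)],
   [(0, 1), (1, 1), (1, 2), (1, 3), (1, 4), (1, 5), (2, 2)],
   [(0, 0), (1, 1), (1, 2), (1, 3), (1, 4), (1, 5), (2, 1)],
   [(0, 1), (1, 1), (1, 2), (1, 3), (1, 4), (1, 5), (2, 5)],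
   [(0, 1), (1, 1), (1, 2), (1, 3), (1, 4), (1, 5), (2, 3)],
   [(0, 1), (1, 1), (1, 2), (1, 3), (1, 4), (1, 5), (2, 1)],
   [(1, 1), (1, 2), (1, 3), (1, 4), (1, 5), (1, 6), (2, 1)]]

/-- Maps that normalise the one-point extensions of the lattice-convex sets of 6 points. -/
def extensionMapsSix : List (List IntAffine) :=
  [[⟨0, 1, 1, 0, 0, 0⟩, ⟨-1, -1, 0, 1, 5, 0⟩, ⟨-1, -1, 1, 0, 5, 0⟩, ⟨1, 0, 0, 1, 0, 0⟩,
     ⟨0, 1, 1, 1, 0, -1⟩, ⟨1, 0, 1, 1, 0, -1⟩, ⟨0, 1, -1, 0, 0, 4⟩, ⟨1, 0, 0, -1, 0, 4⟩,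
     ⟨0, 1, -1, -1, 0, 5⟩, ⟨1, 0, -1, -1, 0, 5⟩, ⟨-1, -1, -1, 0, 5, 4⟩, ⟨-1, -1, 0, -1, 5, 4⟩],
   [⟨0, 1, 1, 0, 0, 0⟩, ⟨0, -1, 1, 0, 3, 0⟩, ⟨0, 1, -1, 0, 0, 4⟩, ⟨0, -1, -1, 0, 3, 4⟩,
     ⟨1, 0, 0, 1, 0, 0⟩, ⟨1, -1, 0, 1, 2, 0⟩, ⟨1, 0, 0, -1, 0, 3⟩, ⟨1, 1, 0, -1, -1, 3⟩],
   [⟨0, 1, 1, 0, 0, 0⟩, ⟨0, 1, -1, -2, 0, 7⟩, ⟨1, 0, 0, 1, 0, 0⟩, ⟨-1, -2, 0, 1, 7, 0⟩],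
   [⟨1, 0, 0, 1, 0, 0⟩, ⟨1, 0, 1, 1, 0, -1⟩, ⟨1, 1, 0, 1, -1, 0⟩, ⟨0, -1, 1, 0, 3, 0⟩,
     ⟨0, 1, -1, 1, 0, 2⟩, ⟨1, 0, -1, 1, 0, 2⟩, ⟨0, 1, -1, 0, 0, 4⟩, ⟨0, -1, 1, 1, 3, -1⟩,
     ⟨-1, -1, -1, 0, 5, 3⟩],
   [⟨0, 1, 1, 0, 0, 0⟩, ⟨1, 0, 0, 1, 0, 0⟩, ⟨-1, 0, 0, 1, 3, 0⟩, ⟨0, -1, 1, 0, 3, 0⟩,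
     ⟨0, 1, -1, 1, 0, 2⟩, ⟨1, 0, 1, -1, 0, 2⟩, ⟨-1, 0, 1, -1, 3, 2⟩, ⟨0, -1, -1, 1, 3, 2⟩,
     ⟨-1, 0, -1, 1, 4, 2⟩],
   [⟨1, 0, 0, 1, 0, 0⟩, ⟨0, 1, 1, 0, 1, 1⟩, ⟨1, 0, -1, 1, 0, 2⟩, ⟨-1, 0, 0, -1, 3, 4⟩],
   [⟨1, 0, 0, 1, 0, 0⟩, ⟨1, 0, 1, 1, 0, 0⟩, ⟨-1, 0, 0, 1, 2, 0⟩, ⟨1, 0, -1, 1, 0, 1⟩,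
     ⟨-1, 0, -1, 1, 2, 1⟩],
   [⟨1, 0, 0, 1, 0, 0⟩, ⟨1, 0, 0, 1, 0, 1⟩, ⟨-1, 0, -1, 1, 2, 1⟩],
   [⟨1, 0, 0, 1, 0, 0⟩, ⟨-1, 0, -1, 1, 2, 1⟩, ⟨1, 0, -2, 1, 0, 2⟩, ⟨1, 0, 1, -1, 0, 4⟩,
     ⟨1, 0, 3, -1, 0, 2⟩, ⟨-1, 0, 2, -1, 2, 3⟩],
   [⟨1, 0, 1, 1, 0, -1⟩, ⟨0, 1, -1, 0, 0, 3⟩, ⟨-1, -1, 0, -1, 4, 3⟩],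
   [⟨1, 0, 0, 1, 0, 0⟩, ⟨1, 0, 1, 1, 0, 0⟩, ⟨-1, 0, 0, 1, 2, 0⟩, ⟨1, 0, -1, 1, 0, 1⟩,
     ⟨-1, 0, -1, 1, 2, 1⟩, ⟨1, 0, -2, 1, 0, 2⟩],
   [⟨1, 0, 0, 1, 0, 0⟩, ⟨1, 0, 1, 1, 0, 0⟩, ⟨-1, 0, 0, 1, 2, 0⟩, ⟨1, 0, 1, 1, 0, -1⟩,
     ⟨-1, 0, -1, 1, 2, 1⟩],
   [⟨-1, 0, 0, 1, 2, 0⟩, ⟨-1, 0, -4, -1, 2, 10⟩, ⟨1, 0, 0, 1, 0, 0⟩, ⟨1, 0, -4, -1, 0, 10⟩,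
     ⟨0, 1, 1, 0, 0, 0⟩, ⟨1, 1, 1, 0, -1, 0⟩]]

theorem classifies_four : Classifies 4 (convexSetsFour.map Prod.fst) :=
  Classifies.extend (B := 12) (L := convexSetsThree) (le_refl 3) classifies_three
    (by decide +kernel)

theorem classifies_five : Classifies 5 (convexSetsFive.map Prod.fst) :=
  classifies_four.extend (B := 12) (by norm_num) (by decide +kernel)

theorem classifies_six : Classifies 6 (genusSixData.map Prod.fst ++ obstructedSetsSix) :=
  classifies_five.extend (B := 12) (by norm_num) (by decide +kernel)

theorem classifies_seven : Classifies 7 (genusSevenData.map Prod.fst ++ obstructedSetsSeven) := by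
  have h := classifies_six
  -- `zip` stops at the shorter list; the `rfl` also certifies that no set is dropped.
  rw [show genusSixData.map Prod.fst ++ obstructedSetsSix =
    ((genusSixData.map Prod.fst ++ obstructedSetsSix).zip extensionMapsSix).map Prod.fst from rfl]
    at h
  exact h.extend (B := 12) (by norm_num) (by decide +kernel)

theorem genusSixData_isRelaxedHull :
    ∀ R ∈ genusSixData, IsRelaxedHull 12 R.1 R.2 ∧ R.1.toFinset.card = 6 := by
  decide +kernel

theorem genusSevenData_isRelaxedHull :
    ∀ R ∈ genusSevenData, IsRelaxedHull 12 R.1 R.2 ∧ R.1.toFinset.card = 7 := by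
  decide +kernel

theorem obstructedSetsSix_isObstructed : ∀ R ∈ obstructedSetsSix, IsObstructed 12 R := by
  decide +kernel

/-- The box size 12 is sharp: the last set has relaxation x ≥ 0, y ≥ 0, 5x + y ≤ 12, which contains
(0, 12). -/
theorem obstructedSetsSeven_isObstructed : ∀ R ∈ obstructedSetsSeven, IsObstructed 12 R := by
  decide +kernel

theorem genusSixPolygons_eq :
    genusSixPolygons = genusSixData.map fun R => latticeHull {p | p ∈ R.2} := by
  simp only [genusSixPolygons, genusSixData, List.map_cons, List.map_nil, List.mem_cons,
    List.not_mem_nil, or_false]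
  -- Membership in an explicit list is now a disjunction of equations, to which the set literal
  -- unfolds.
  rfl

theorem genusSevenPolygons_eq :
    genusSevenPolygons = genusSevenData.map fun R => latticeHull {p | p ∈ R.2} := by
  simp only [genusSevenPolygons, genusSevenData, List.map_cons, List.map_nil, List.mem_cons,
    List.not_mem_nil, or_false]
  rfl

theorem pairwise_not_latticeEquivalent {B g : ℕ} {L : List (List (ℤ × ℤ) × List (ℤ × ℤ))}
    (hL : ∀ R ∈ L, IsRelaxedHull B R.1 R.2 ∧ R.1.toFinset.card = g)
    (hinv : (L.map fun R => quarticInvariant R.1.toFinset).Nodup) :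
    (L.map fun R => latticeHull {p | p ∈ R.2}).Pairwise fun P Q => ¬ LatticeEquivalent P Q := by
  rw [List.Nodup, List.pairwise_map] at hinv
  rw [List.pairwise_map]
  exact hinv.imp_of_mem fun hR hR' hne => not_latticeEquivalent (hL _ hR).1 (hL _ hR').1 hne

theorem proposition3p10 :
    ((∀ P : Set (ℝ × ℝ), IsMaximalNonhyperelliptic 6 P ↔
        ∃ Q ∈ genusSixPolygons, LatticeEquivalent P Q) ∧
      genusSixPolygons.Pairwise (fun P Q => ¬ LatticeEquivalent P Q)) ∧
    ((∀ P : Set (ℝ × ℝ), IsMaximalNonhyperelliptic 7 P ↔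
        ∃ Q ∈ genusSevenPolygons, LatticeEquivalent P Q) ∧
      genusSevenPolygons.Pairwise (fun P Q => ¬ LatticeEquivalent P Q)) := by
  rw [genusSixPolygons_eq, genusSevenPolygons_eq]
  exact ⟨⟨isMaximalNonhyperelliptic_iff (by norm_num) classifies_six genusSixData_isRelaxedHull
      obstructedSetsSix_isObstructed,
    pairwise_not_latticeEquivalent genusSixData_isRelaxedHull (by decide +kernel)⟩,
    ⟨isMaximalNonhyperelliptic_iff (by norm_num) classifies_seven genusSevenData_isRelaxedHull
      obstructedSetsSeven_isObstructed,
    pairwise_not_latticeEquivalent genusSevenData_isRelaxedHull (by decide +kernel)⟩⟩
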